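/- Let $G$ be a hyperbolic group, that is, a group with a finite generating set $S$ whose Cayley graph $\Gamma(G,S)$ (a geodesic metric space in which every edge has length $1$) is $\delta$-hyperbolic for some $\delta\ge 0$: every geodesic triangle in it is $\delta$-thin, meaning that for every vertex $A$ of the triangle, with $B,C$ the other two vertices, and for all points $P\in[A,B]$, $Q\in[A,C]$ on its sides with $|AP|=|AQ|\le \frac12\bigl(|AB|+|AC|-|BC|\bigr)$ one has $|PQ|\le\delta$. Let $H_1$ be a quasiconvex subgroup of $G$, that is, a subgroup such that, for some finite generating set $T$ of $G$ and some $\varepsilon\ge 0$, every geodesic in $\Gamma(G,T)$ with ends in $H_1$ lies in the $\varepsilon$-neighbourhood of $H_1$. Let $H_2$ be an arbitrary subgroup of $G$. Suppose that $H_2$ is elementwise conjugate into $H_1$: for every $h\in H_2$ there is $g\in G$ with $g^{-1}hg\in H_1$. Then there exists a subgroup $K\le H_2$ of finite index in $H_2$ which is conjugate into $H_1$, i.e. $c^{-1}Kc\le H_1$ for some $c\in G$. -/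

import Mathlib

/-! ### The metric realization of a connected graph -/

/-- Names for the points of the metric realization of a connected simple graph: a vertex, or the
point at distance `t` from `d.fst` on the unit-length edge underlying the dart `d`.
A point may have several names; these are identified in `GraphRealization`. -/
inductive GraphPoint {V : Type*} (Γ : SimpleGraph V) (hΓ : Γ.Connected) : Type _
  | vertex (v : V) : GraphPoint Γ hΓ
  | onDart (d : Γ.Dart) (t : Set.Icc (0 : ℝ) 1) : GraphPoint Γ hΓ

namespace GraphPoint

variable {V : Type*} {Γ : SimpleGraph V} {hΓ : Γ.Connected}

/-- The two ends of the closed edge (or one-point set) on which a point is given. -/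
def endpoint : GraphPoint Γ hΓ → Bool → V
  | .vertex v, _ => v
  | .onDart d _, false => d.fst
  | .onDart d _, true => d.snd

/-- The distance along that edge from the point to each of the ends. -/
def toEnd : GraphPoint Γ hΓ → Bool → ℝ
  | .vertex _, _ => 0
  | .onDart _ t, false => t
  | .onDart _ t, true => 1 - t

/-- The length of a shortest path between two points that runs through an end of the edge
carrying the first point and an end of the edge carrying the second one. -/
noncomputable def route (p q : GraphPoint Γ hΓ) : ℝ :=
  ⨅ e : Bool × Bool,
    (toEnd p e.1 + (Γ.dist (endpoint p e.1) (endpoint q e.2) : ℝ) + toEnd q e.2)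

open Classical in
/-- The path metric: two points on one edge are joined by a segment of that edge, any other two
points by a shortest path through ends of their edges. -/
noncomputable def pathDist : GraphPoint Γ hΓ → GraphPoint Γ hΓ → ℝ
  | .onDart d t, .onDart d' t' =>
      if d' = d then |(t : ℝ) - t'|
      else if d' = d.symm then |(t : ℝ) - (1 - t')|
      else route (hΓ := hΓ) (.onDart d t) (.onDart d' t')
  | p, q => route p q

theorem toEnd_nonneg (p : GraphPoint Γ hΓ) (i : Bool) : 0 ≤ toEnd p i := by
  rcases p with v | ⟨d, t, h0, h1⟩ <;> cases i <;> simp [toEnd] <;> linarith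

theorem route_le (p q : GraphPoint Γ hΓ) (i j : Bool) :
    route p q ≤ toEnd p i + (Γ.dist (endpoint p i) (endpoint q j) : ℝ) + toEnd q j :=
  ciInf_le (f := fun e : Bool × Bool =>
    toEnd p e.1 + (Γ.dist (endpoint p e.1) (endpoint q e.2) : ℝ) + toEnd q e.2)
    (Set.finite_range _).bddBelow (i, j)

theorem exists_route (p q : GraphPoint Γ hΓ) : ∃ i j,
    route p q = toEnd p i + (Γ.dist (endpoint p i) (endpoint q j) : ℝ) + toEnd q j := by
  obtain ⟨e, he⟩ := exists_eq_ciInf_of_finite (f := fun e : Bool × Bool =>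
    toEnd p e.1 + (Γ.dist (endpoint p e.1) (endpoint q e.2) : ℝ) + toEnd q e.2)
  exact ⟨e.1, e.2, he.symm⟩

theorem route_comm (p q : GraphPoint Γ hΓ) : route p q = route q p := by
  apply le_antisymm
  · obtain ⟨i, j, h⟩ := exists_route q p
    have := route_le p q j i
    rw [SimpleGraph.dist_comm] at this
    linarith
  · obtain ⟨i, j, h⟩ := exists_route p q
    have := route_le q p j i
    rw [SimpleGraph.dist_comm] at this
    linarith

theorem route_nonneg (p q : GraphPoint Γ hΓ) : 0 ≤ route p q := by
  obtain ⟨i, j, h⟩ := exists_route p q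
  rw [h]
  have := toEnd_nonneg p i
  have := toEnd_nonneg q j
  positivity

theorem pathDist_nonneg (p q : GraphPoint Γ hΓ) : 0 ≤ pathDist p q := by
  unfold pathDist
  split
  · split_ifs <;> first | positivity | exact route_nonneg _ _
  · exact route_nonneg _ _

theorem pathDist_self (p : GraphPoint Γ hΓ) : pathDist p p = 0 := by
  rcases p with v | ⟨d, t⟩
  · refine le_antisymm ?_ (pathDist_nonneg _ _)
    have h := route_le (vertex v : GraphPoint Γ hΓ) (vertex v) true true
    simpa [toEnd, endpoint, pathDist] using h
  · simp [pathDist]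

theorem pathDist_comm (p q : GraphPoint Γ hΓ) : pathDist p q = pathDist q p := by
  rcases p with v | ⟨d, t⟩ <;> rcases q with w | ⟨d', t'⟩
  · exact route_comm _ _
  · exact route_comm _ _
  · exact route_comm _ _
  · by_cases h : d' = d
    · subst h
      simp [pathDist, abs_sub_comm]
    · by_cases h' : d' = d.symm
      · have h2 : d = d'.symm := by rw [h', SimpleGraph.Dart.symm_symm]
        simp only [pathDist, if_neg h, if_pos h', if_neg (Ne.symm h), if_pos h2]
        congr 1
        ring
      · have h2 : ¬ d = d'.symm := fun h2 => h' (by rw [h2, SimpleGraph.Dart.symm_symm])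
        simp only [pathDist, if_neg h, if_neg h', if_neg (Ne.symm h), if_neg h2]
        exact route_comm _ _

theorem toEnd_dart_sub (d : Γ.Dart) (i j : Bool) (t : Set.Icc (0 : ℝ) 1) :
    (Γ.dist (endpoint (onDart d t : GraphPoint Γ hΓ) i)
      (endpoint (onDart d t : GraphPoint Γ hΓ) j) : ℝ) ≤
    toEnd (onDart d t : GraphPoint Γ hΓ) i + toEnd (onDart d t : GraphPoint Γ hΓ) j := by
  obtain ⟨t, h0, h1⟩ := t
  have h := SimpleGraph.dist_eq_one_iff_adj.2 d.adj
  have h' := SimpleGraph.dist_eq_one_iff_adj.2 d.adj.symm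
  cases i <;> cases j <;> simp [endpoint, toEnd, h, h'] <;> linarith

/-- The distance between two ends of the edge of `p` is at most the length through `p`. -/
theorem dist_ends_le (p : GraphPoint Γ hΓ) (i j : Bool) :
    (Γ.dist (endpoint p i) (endpoint p j) : ℝ) ≤ toEnd p i + toEnd p j := by
  rcases p with v | ⟨d, t⟩
  · simp [endpoint, toEnd]
  · exact toEnd_dart_sub d i j t

/-- The path distance is either given by a route through ends or measured along one edge. -/
theorem pathDist_cases (p q : GraphPoint Γ hΓ) : pathDist p q = route p q ∨
    ∃ (d : Γ.Dart) (t t' : Set.Icc (0 : ℝ) 1), p = onDart d t ∧ pathDist p q = |(t : ℝ) - t'| ∧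
      (q = onDart d t' ∨ q = onDart d.symm ⟨1 - t', by linarith [t'.2.2], by linarith [t'.2.1]⟩) := by
  rcases p with v | ⟨d, t⟩ <;> rcases q with w | ⟨d', t'⟩
  · exact Or.inl rfl
  · exact Or.inl rfl
  · exact Or.inl rfl
  · by_cases h : d' = d
    · subst h
      exact Or.inr ⟨d', t, t', rfl, by simp [pathDist], Or.inl rfl⟩
    · by_cases h' : d' = d.symm
      · refine Or.inr ⟨d, t, ⟨1 - t', by linarith [t'.2.2], by linarith [t'.2.1]⟩, rfl, ?_, ?_⟩
        · simp only [pathDist, if_neg h, if_pos h']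
        · right
          subst h'
          simp
      · left
        simp only [pathDist, if_neg h, if_neg h']

/-- The length to the ends of an edge varies along that edge as the segment length does. -/
theorem exists_end (p q : GraphPoint Γ hΓ) (i : Bool)
    (h : ∃ (d : Γ.Dart) (t t' : Set.Icc (0 : ℝ) 1), p = onDart d t ∧ pathDist p q = |(t : ℝ) - t'| ∧
      (q = onDart d t' ∨ q = onDart d.symm ⟨1 - t', by linarith [t'.2.2], by linarith [t'.2.1]⟩)) :
    ∃ j, endpoint q j = endpoint p i ∧ toEnd q j ≤ toEnd p i + pathDist p q ∧
      toEnd p i ≤ toEnd q j + pathDist p q := by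
  obtain ⟨d, t, t', rfl, hr, rfl | rfl⟩ := h
  · refine ⟨i, by cases i <;> rfl, ?_⟩
    rw [hr]
    rcases abs_cases ((t : ℝ) - t') with h | h <;> cases i <;> simp only [toEnd] <;>
      constructor <;> linarith
  · refine ⟨!i, by cases i <;> rfl, ?_⟩
    rw [hr]
    rcases abs_cases ((t : ℝ) - t') with h | h <;> cases i <;> simp only [toEnd, Bool.not_true,
      Bool.not_false] <;> constructor <;> linarith

theorem pathDist_le (p q : GraphPoint Γ hΓ) (i j : Bool) :
    pathDist p q ≤ toEnd p i + (Γ.dist (endpoint p i) (endpoint q j) : ℝ) + toEnd q j := by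
  rcases pathDist_cases p q with h | h
  · rw [h]
    exact route_le p q i j
  · obtain ⟨d, t, t', rfl, hr, rfl | rfl⟩ := h <;> rw [hr] <;> obtain ⟨t, h0, h1⟩ := t <;>
      obtain ⟨t', h0', h1'⟩ := t' <;>
      have h := SimpleGraph.dist_eq_one_iff_adj.2 d.adj <;>
      have h' := SimpleGraph.dist_eq_one_iff_adj.2 d.adj.symm <;>
      rcases abs_cases (t - t') with ha | ha <;>
      cases i <;> cases j <;> simp [endpoint, toEnd, h, h'] <;> linarith

theorem pathDist_triangle (p q r : GraphPoint Γ hΓ) :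
    pathDist p r ≤ pathDist p q + pathDist q r := by
  rcases pathDist_cases p q with h1 | h1
  · obtain ⟨i, j, hij⟩ := exists_route p q
    rw [← h1] at hij
    rcases pathDist_cases q r with h2 | h2
    · obtain ⟨k, l, hkl⟩ := exists_route q r
      rw [← h2] at hkl
      have a := pathDist_le p r i l
      have b := dist_ends_le q j k
      have c : (Γ.dist (endpoint p i) (endpoint r l) : ℝ) ≤
          Γ.dist (endpoint p i) (endpoint q j) + Γ.dist (endpoint q j) (endpoint q k) +
          Γ.dist (endpoint q k) (endpoint r l) := by
        have c1 := hΓ.dist_triangle (u := endpoint p i) (v := endpoint q j) (w := endpoint q k)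
        have c2 := hΓ.dist_triangle (u := endpoint p i) (v := endpoint q k) (w := endpoint r l)
        exact_mod_cast c2.trans (Nat.add_le_add_right c1 _)
      linarith
    · obtain ⟨k, hk, hk1, hk2⟩ := exists_end q r j h2
      have a := pathDist_le p r i k
      rw [hk] at a
      linarith
  · rcases pathDist_cases q r with h2 | h2
    · obtain ⟨k, l, hkl⟩ := exists_route q r
      rw [← h2] at hkl
      have h3 : ∃ j, endpoint p j = endpoint q k ∧ toEnd p j ≤ toEnd q k + pathDist p q := by
        obtain ⟨j0, hj0, -, ha⟩ := exists_end p q false h1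
        obtain ⟨j1, hj1, -, hb⟩ := exists_end p q true h1
        have hne : j0 ≠ j1 := by
          rintro rfl
          obtain ⟨d, t, t', rfl, -⟩ := h1
          exact d.adj.ne (hj0.symm.trans hj1)
        have hk : k = j0 ∨ k = j1 := by
          revert hne; cases j0 <;> cases j1 <;> cases k <;> simp
        rcases hk with rfl | rfl
        · exact ⟨_, hj0.symm, ha⟩
        · exact ⟨_, hj1.symm, hb⟩
      obtain ⟨j, hj, hj1⟩ := h3
      have a := pathDist_le p r j l
      rw [hj] at a
      linarith
    · obtain ⟨d, t, t', rfl, hr, hq⟩ := h1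
      obtain ⟨e, s, s', hq', hs, hr'⟩ := h2
      rw [hr, hs]
      have tri := abs_sub_le (t : ℝ) t' s'
      have tri' := abs_sub_le (t : ℝ) t' (1 - s')
      have hsym : d.symm ≠ d := SimpleGraph.Dart.symm_ne d
      have hsym' : d ≠ d.symm := hsym.symm
      rcases hq with rfl | rfl
      · cases hq'
        rcases hr' with rfl | rfl <;> simpa [pathDist, hsym] using tri
      · cases hq'
        have e : |1 - (t' : ℝ) - s'| = |(t' : ℝ) - (1 - s')| := by
          rw [← abs_neg]
          congr 1
          ring
        rcases hr' with rfl | rfl <;> simp [pathDist, hsym, SimpleGraph.Dart.symm_symm] <;>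
          rw [e] <;> exact tri'

noncomputable instance : PseudoMetricSpace (GraphPoint Γ hΓ) where
  dist := pathDist
  dist_self := pathDist_self
  dist_comm := pathDist_comm
  dist_triangle := pathDist_triangle

end GraphPoint

/-- The metric realization of a connected simple graph: every edge is a unit interval, and the
distance is the path metric. (Two names have distance `0` only if they name the same point.) -/
abbrev GraphRealization {V : Type*} (Γ : SimpleGraph V) (hΓ : Γ.Connected) : Type _ :=
  SeparationQuotient (GraphPoint Γ hΓ)

/-! ### Geodesics, hyperbolicity and quasiconvexity in metric spaces -/

section Metric

variable {X : Type*} [MetricSpace X]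

/-- `σ` is (the image of) a geodesic segment with ends `A` and `B`. -/
def IsGeodesicSegment (A B : X) (σ : Set X) : Prop :=
  ∃ γ : ℝ → X, γ 0 = A ∧ γ (dist A B) = B ∧
    (∀ s ∈ Set.Icc 0 (dist A B), ∀ t ∈ Set.Icc 0 (dist A B), dist (γ s) (γ t) = |s - t|) ∧
    σ = γ '' Set.Icc 0 (dist A B)

/-- The Gromov inner product `(B, C)_A`. -/
noncomputable def gromovProduct (A B C : X) : ℝ :=
  (dist A B + dist A C - dist B C) / 2

/-- The thinness condition at the vertex `A` of a geodesic triangle with vertices `A, B, C`,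
where `σ` is the side `[A, B]` and `τ` is the side `[A, C]`. -/
def IsThinAt (δ : ℝ) (A B C : X) (σ τ : Set X) : Prop :=
  ∀ P ∈ σ, ∀ Q ∈ τ, dist A P = dist A Q → dist A P ≤ gromovProduct A B C → dist P Q ≤ δ

variable (X) in
/-- A (geodesic) metric space is `δ`-hyperbolic if every geodesic triangle in it is `δ`-thin. -/
def IsDeltaHyperbolic (δ : ℝ) : Prop :=
  ∀ (A B C : X) (a b c : Set X),
    IsGeodesicSegment B C a → IsGeodesicSegment C A b → IsGeodesicSegment A B c →
      IsThinAt δ A B C c b ∧ IsThinAt δ B C A a c ∧ IsThinAt δ C A B b a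

/-- A subset `Y` of a (geodesic) metric space is `ε`-quasiconvex if every geodesic with ends
in `Y` lies in the `ε`-neighbourhood of `Y`. -/
def IsQuasiconvexSet (ε : ℝ) (Y : Set X) : Prop :=
  ∀ A ∈ Y, ∀ B ∈ Y, ∀ σ : Set X, IsGeodesicSegment A B σ → ∀ P ∈ σ, ∃ y ∈ Y, dist P y ≤ ε

end Metric

/-! ### Cayley graphs, hyperbolic groups and quasiconvex subgroups -/

section Group

variable {G : Type*} [Group G]

/-- The Cayley graph with respect to a generating set is connected. -/
theorem mulCayley_connected {S : Set G} (hS : Subgroup.closure S = ⊤) :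
    (SimpleGraph.mulCayley S).Connected := by
  have key : ∀ x : G, ∀ g : G, (SimpleGraph.mulCayley S).Reachable g (g * x) := by
    intro x
    have hx : x ∈ Subgroup.closure S := by rw [hS]; trivial
    induction hx using Subgroup.closure_induction with
    | mem s hs =>
      intro g
      by_cases h : g = g * s
      · rw [← h]
      · exact SimpleGraph.Adj.reachable
          ((SimpleGraph.mulCayley_adj S _ _).2 ⟨h, Or.inl (by simpa using hs)⟩)
    | one => intro g; rw [mul_one]
    | mul x y _ _ hx hy =>
      intro g
      rw [← mul_assoc]
      exact (hx g).trans (hy _)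
    | inv x _ hx =>
      intro g
      simpa using (hx (g * x⁻¹)).symm
  exact ⟨fun u v => by simpa using key (u⁻¹ * v) u⟩

/-- The Cayley graph `Γ(G, S)` with respect to a generating set `S`, as a metric space in which
every edge has length `1`. -/
abbrev CayleySpace (S : Set G) (hS : Subgroup.closure S = ⊤) : Type _ :=
  GraphRealization (SimpleGraph.mulCayley S) (mulCayley_connected hS)

/-- The vertex `g` of the Cayley graph. -/
noncomputable def cayleyVertex (S : Set G) (hS : Subgroup.closure S = ⊤) (g : G) : CayleySpace S hS :=
  SeparationQuotient.mk (GraphPoint.vertex g)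

variable (G) in
/-- A hyperbolic group: it has a finite generating set whose Cayley graph is `δ`-hyperbolic for
some `δ`. -/
def IsHyperbolicGroup : Prop :=
  ∃ (S : Set G) (_ : S.Finite) (hS : Subgroup.closure S = ⊤) (δ : ℝ),
    0 ≤ δ ∧ IsDeltaHyperbolic (CayleySpace S hS) δ

/-- A subgroup `H` is quasiconvex if it is a quasiconvex subset of the Cayley graph with respect to
some finite generating set of the ambient group. -/
def IsQuasiconvexSubgroup (H : Subgroup G) : Prop :=
  ∃ (S : Set G) (_ : S.Finite) (hS : Subgroup.closure S = ⊤) (ε : ℝ),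
    0 ≤ ε ∧ IsQuasiconvexSet ε (cayleyVertex S hS '' (H : Set G))

/-- `A` is conjugate into `B`: `c⁻¹ A c ≤ B` for some `c`. -/
def IsConjugateInto (A B : Subgroup G) : Prop :=
  ∃ c : G, ∀ a ∈ A, c⁻¹ * a * c ∈ B

/-- `A` is elementwise conjugate into `B`: every element of `A` is conjugate to an element
of `B`. -/
def IsElementwiseConjugateInto (A B : Subgroup G) : Prop :=
  ∀ a ∈ A, ∃ c : G, c⁻¹ * a * c ∈ B

end Group

/-!
Distances between vertices of a Cayley graph form a left-invariant integer-valued word metric `d`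
with finite balls, and thin triangles give the four-point inequality for it
(`fourPoint_of_isDeltaHyperbolic`). From then on everything is an inequality between word lengths.

The subgroup `H₁` is assumed quasiconvex for a possibly different generating set. This yields chains
inside `H₁` of bounded step and linear length (`hasLinearChains_of_isQuasiconvexSet`), a property
that does not depend on the generating set; exponential divergence turns it back into
quasiconvexity for the word metric in which `G` is known to be hyperbolic
(`exists_quasiconvexity_constant`).

Let `x` be an element whose Gromov product `(x, x⁻¹)` at `1` is at most `c`, and which is long
compared with `c`. Its powers form a quasigeodesic through `1`. If `x ∈ g H₁ g⁻¹`, then the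
coset `g H₁` contains `x ^ n * g` for all `n`, hence points near the directions of both ends of the
quasigeodesic and, being quasiconvex, it passes at bounded distance from `1`. So `x ∈ r H₁ r⁻¹` for
one of finitely many `r` (`exists_short_conjugator`).

There are two cases. Suppose that finitely many `f ∈ H₂` suffice to correct every `x ∈ H₂` to an
element `f * x` with bounded Gromov product `(f * x, (f * x)⁻¹)`. Then `H₂` is covered by finitely
many cosets of the subgroups `H₂ ∩ r H₁ r⁻¹`, and by B. H. Neumann's lemma one of these has finite
index (`exists_finiteIndex_of_bounded_correction`). Otherwise, `H₂` almost fixes the directions of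
points `p` that tend to infinity. The change `f ↦ d 1 (f * p) - d 1 p` converges along an ultrafilter
to a quasimorphism `H₂ → ℤ`, which takes each bounded range of values only finitely often because
balls are finite. Hence `H₂` has a cyclic subgroup of finite index
(`exists_finiteIndex_zpowers_of_almost_fixed`), and a cyclic subgroup is conjugate into `H₁` as soon
as its generator is.
-/

/-! ### Geodesics of the metric realization of a graph -/

section Realization

variable {V : Type*} {Γ : SimpleGraph V} {hΓ : Γ.Connected}

theorem GraphPoint.pathDist_vertex (u v : V) :
    GraphPoint.pathDist (GraphPoint.vertex u : GraphPoint Γ hΓ) (GraphPoint.vertex v) =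
      Γ.dist u v := by
  obtain ⟨i, j, h⟩ := GraphPoint.exists_route (GraphPoint.vertex u : GraphPoint Γ hΓ)
    (GraphPoint.vertex v)
  simpa [GraphPoint.toEnd, GraphPoint.endpoint, GraphPoint.pathDist] using h

/-- The point of the realization named by a vertex. -/
noncomputable def realizedVertex (hΓ : Γ.Connected) (v : V) : GraphRealization Γ hΓ :=
  SeparationQuotient.mk (GraphPoint.vertex v)

theorem dist_realizedVertex (u v : V) :
    dist (realizedVertex hΓ u) (realizedVertex hΓ v) = Γ.dist u v :=
  GraphPoint.pathDist_vertex u v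

theorem SimpleGraph.Walk.dist_getVert_le {u v : V} (hΓ : Γ.Connected) (p : Γ.Walk u v) {i j : ℕ}
    (hij : i ≤ j) : Γ.dist (p.getVert i) (p.getVert j) ≤ j - i := by
  induction j, hij using Nat.le_induction with
  | base => simp
  | succ j hij ih =>
    have h1 : Γ.dist (p.getVert j) (p.getVert (j + 1)) ≤ 1 := by
      by_cases hj : j < p.length
      · exact (SimpleGraph.dist_eq_one_iff_adj.2 (p.adj_getVert_succ hj)).le
      · rw [p.getVert_of_length_le (by omega), p.getVert_of_length_le (by omega)]
        simp
    have h2 := hΓ.dist_triangle (u := p.getVert i) (v := p.getVert j) (w := p.getVert (j + 1))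
    omega

open Classical in
/-- The point at distance `r` from the `i`-th vertex on the `i`-th edge of a walk; beyond the end
of the walk, its last vertex. -/
noncomputable def SimpleGraph.Walk.edgePoint (hΓ : Γ.Connected) {u v : V} (p : Γ.Walk u v) (i : ℕ)
    (r : Set.Icc (0 : ℝ) 1) : GraphPoint Γ hΓ :=
  if h : Γ.Adj (p.getVert i) (p.getVert (i + 1)) then
    .onDart ⟨(p.getVert i, p.getVert (i + 1)), h⟩ r
  else .vertex (p.getVert i)

/-- The point at distance `s` from the start along a walk. -/
noncomputable def SimpleGraph.Walk.pointAt (hΓ : Γ.Connected) {u v : V} (p : Γ.Walk u v) (s : ℝ) :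
    GraphPoint Γ hΓ :=
  p.edgePoint hΓ ⌊s⌋₊ ⟨Int.fract s, Int.fract_nonneg s, (Int.fract_lt_one s).le⟩

theorem SimpleGraph.Walk.pathDist_edgePoint_same {u v : V} (p : Γ.Walk u v) (i : ℕ)
    (r r' : Set.Icc (0 : ℝ) 1) :
    GraphPoint.pathDist (p.edgePoint hΓ i r) (p.edgePoint hΓ i r') ≤ |(r : ℝ) - r'| := by
  unfold SimpleGraph.Walk.edgePoint
  split_ifs
  · simp [GraphPoint.pathDist]
  · rw [GraphPoint.pathDist_self]
    positivity

theorem SimpleGraph.Walk.pathDist_edgePoint_lt {u v : V} (p : Γ.Walk u v) {i j : ℕ}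
    (hij : i < j) (hi : i < p.length) (r r' : Set.Icc (0 : ℝ) 1) :
    GraphPoint.pathDist (p.edgePoint hΓ i r) (p.edgePoint hΓ j r') ≤ (j + r') - (i + r) := by
  have h := GraphPoint.pathDist_le (p.edgePoint hΓ i r) (p.edgePoint hΓ j r') true false
  have e1 : GraphPoint.endpoint (p.edgePoint hΓ i r) true = p.getVert (i + 1) := by
    simp [edgePoint, p.adj_getVert_succ hi, GraphPoint.endpoint]
  have e2 : GraphPoint.endpoint (p.edgePoint hΓ j r') false = p.getVert j := by
    unfold edgePoint
    split_ifs <;> simp [GraphPoint.endpoint]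
  have t1 : GraphPoint.toEnd (p.edgePoint hΓ i r) true = 1 - r := by
    simp [edgePoint, p.adj_getVert_succ hi, GraphPoint.toEnd]
  have t2 : GraphPoint.toEnd (p.edgePoint hΓ j r') false ≤ r' := by
    unfold edgePoint
    split_ifs
    · simp [GraphPoint.toEnd]
    · simpa [GraphPoint.toEnd] using r'.2.1
  rw [e1, e2, t1] at h
  have h3 := p.dist_getVert_le hΓ (Nat.succ_le_of_lt hij)
  have h4 : (Γ.dist (p.getVert (i + 1)) (p.getVert j) : ℝ) + (i + 1) ≤ j := by
    have : Γ.dist (p.getVert (i + 1)) (p.getVert j) + (i + 1) ≤ j := by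
      simp only [Nat.succ_eq_add_one] at h3
      omega
    exact_mod_cast this
  linarith

theorem SimpleGraph.Walk.pathDist_pointAt_le {u v : V} (p : Γ.Walk u v) {s t : ℝ} (hs : 0 ≤ s)
    (hst : s ≤ t) (ht : t ≤ p.length) :
    GraphPoint.pathDist (p.pointAt hΓ s) (p.pointAt hΓ t) ≤ t - s := by
  have fs : (⌊s⌋₊ : ℝ) + Int.fract s = s := by
    rw [natCast_floor_eq_intCast_floor hs, Int.floor_add_fract]
  have ft : (⌊t⌋₊ : ℝ) + Int.fract t = t := by
    rw [natCast_floor_eq_intCast_floor (hs.trans hst), Int.floor_add_fract]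
  unfold pointAt
  rcases (Nat.floor_mono hst).eq_or_lt with h | h
  · rw [h]
    refine (p.pathDist_edgePoint_same _ _ _).trans ?_
    rw [abs_sub_comm, abs_of_nonneg]
    · rw [h] at fs
      simp only
      linarith
    · rw [h] at fs
      simp only
      linarith
  · have hlen : ⌊t⌋₊ ≤ p.length := Nat.floor_le_of_le ht
    refine (p.pathDist_edgePoint_lt h (by omega) _ _).trans ?_
    simp only
    linarith

theorem SimpleGraph.Walk.pathDist_pointAt_natCast {u v : V} (p : Γ.Walk u v) (i : ℕ) :
    GraphPoint.pathDist (p.pointAt hΓ i) (GraphPoint.vertex (p.getVert i)) = 0 := by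
  refine le_antisymm ?_ (GraphPoint.pathDist_nonneg _ _)
  refine (GraphPoint.pathDist_le _ _ false false).trans ?_
  unfold pointAt edgePoint
  split_ifs <;> simp [GraphPoint.endpoint, GraphPoint.toEnd]

/-- A shortest walk is a geodesic segment of the realization. -/
theorem SimpleGraph.Walk.isGeodesicSegment {u v : V} (p : Γ.Walk u v)
    (hp : p.length = Γ.dist u v) :
    IsGeodesicSegment (realizedVertex hΓ u) (realizedVertex hΓ v)
        ((fun s : ℝ => (SeparationQuotient.mk (p.pointAt hΓ s) : GraphRealization Γ hΓ)) ''
          Set.Icc 0 (Γ.dist u v)) ∧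
      ∀ i ≤ p.length, realizedVertex hΓ (p.getVert i) ∈
        ((fun s : ℝ => (SeparationQuotient.mk (p.pointAt hΓ s) : GraphRealization Γ hΓ)) ''
          Set.Icc 0 (Γ.dist u v)) := by
  have hd : ∀ s t : ℝ, Dist.dist (SeparationQuotient.mk (p.pointAt hΓ s) : GraphRealization Γ hΓ)
      (SeparationQuotient.mk (p.pointAt hΓ t)) =
      GraphPoint.pathDist (p.pointAt hΓ s) (p.pointAt hΓ t) := fun _ _ => rfl
  have hv : ∀ i : ℕ, (SeparationQuotient.mk (p.pointAt hΓ i) : GraphRealization Γ hΓ) =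
      realizedVertex hΓ (p.getVert i) := fun i =>
    dist_eq_zero.1 (p.pathDist_pointAt_natCast i)
  have h0 : (SeparationQuotient.mk (p.pointAt hΓ 0) : GraphRealization Γ hΓ) =
      realizedVertex hΓ u := by simpa using hv 0
  have hn : (SeparationQuotient.mk (p.pointAt hΓ (Γ.dist u v)) : GraphRealization Γ hΓ) =
      realizedVertex hΓ v := by
    rw [← hp]
    simpa using hv p.length
  have hlen : (p.length : ℝ) = Γ.dist u v := by rw [hp]
  -- The arc-length parametrization is `1`-Lipschitz and its ends are at the full distance, so
  -- that it is isometric.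
  have key : ∀ s t : ℝ, 0 ≤ s → s ≤ t → t ≤ Γ.dist u v →
      Dist.dist (SeparationQuotient.mk (p.pointAt hΓ s) : GraphRealization Γ hΓ)
        (SeparationQuotient.mk (p.pointAt hΓ t)) = t - s := by
    intro s t hs hst ht
    refine le_antisymm ((hd s t).trans_le (p.pathDist_pointAt_le hs hst (ht.trans_eq hlen.symm))) ?_
    have a := (hd 0 s).trans_le
      (p.pathDist_pointAt_le le_rfl hs (hst.trans (ht.trans_eq hlen.symm)))
    have b := (hd t _).trans_le (p.pathDist_pointAt_le (hs.trans hst) ht hlen.symm.le)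
    rw [h0] at a
    rw [hn] at b
    have c := dist_triangle4 (realizedVertex hΓ u)
      (SeparationQuotient.mk (p.pointAt hΓ s) : GraphRealization Γ hΓ)
      (SeparationQuotient.mk (p.pointAt hΓ t)) (realizedVertex hΓ v)
    rw [dist_realizedVertex] at c
    linarith
  refine ⟨⟨fun s => SeparationQuotient.mk (p.pointAt hΓ s), h0, ?_, ?_, ?_⟩, ?_⟩
  · rw [dist_realizedVertex]
    exact hn
  · rw [dist_realizedVertex]
    intro s hs t ht
    rcases le_total s t with h | h
    · rw [key s t hs.1 h ht.2, abs_sub_comm, abs_of_nonneg (by linarith)]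
    · rw [_root_.dist_comm, key t s ht.1 h hs.2, abs_of_nonneg (by linarith)]
  · rw [dist_realizedVertex]
  · intro i hi
    refine ⟨i, ⟨by positivity, ?_⟩, hv i⟩
    rw [← hp]
    exact_mod_cast hi

theorem SimpleGraph.Walk.dist_getVert_of_shortest {u v : V} (hΓ : Γ.Connected) (p : Γ.Walk u v)
    (hp : p.length = Γ.dist u v) {i : ℕ} (hi : i ≤ p.length) :
    Γ.dist u (p.getVert i) = i ∧ Γ.dist (p.getVert i) v = Γ.dist u v - i := by
  have a := p.dist_getVert_le hΓ (Nat.zero_le i)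
  have b := p.dist_getVert_le hΓ hi
  have c := hΓ.dist_triangle (u := u) (v := p.getVert i) (w := v)
  rw [p.getVert_zero] at a
  rw [p.getVert_length] at b
  omega

theorem IsGeodesicSegment.symm {X : Type*} [MetricSpace X] {A B : X} {σ : Set X}
    (h : IsGeodesicSegment A B σ) : IsGeodesicSegment B A σ := by
  obtain ⟨γ, h0, h1, hd, rfl⟩ := h
  refine ⟨fun s => γ (dist A B - s), by simpa using h1, by simpa [dist_comm B A] using h0, ?_, ?_⟩
  · intro s hs t ht
    rw [dist_comm B A] at hs ht
    rw [hd _ ⟨by linarith [hs.2], by linarith [hs.1]⟩ _ ⟨by linarith [ht.2], by linarith [ht.1]⟩,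
      abs_sub_comm]
    congr 1
    ring
  · rw [dist_comm B A]
    ext x
    constructor
    · rintro ⟨s, hs, rfl⟩
      exact ⟨dist A B - s, ⟨by linarith [hs.2], by linarith [hs.1]⟩, by simp⟩
    · rintro ⟨s, hs, rfl⟩
      exact ⟨dist A B - s, ⟨by linarith [hs.2], by linarith [hs.1]⟩, rfl⟩

/-- A four-point form of hyperbolicity for an integer-valued distance: the largest two of the
three sums of opposite distances differ by at most `δ`. With base point `w`, it says that
`(x, z) ≥ min ((x, y), (y, z)) - δ / 2` for Gromov products. -/
def FourPoint {V : Type*} (d : V → V → ℕ) (δ : ℕ) : Prop :=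
  ∀ w x y z, d x z + d w y ≤ max (d x y + d w z) (d y z + d w x) + δ

theorem fourPoint_of_isDeltaHyperbolic {δ : ℝ}
    (h : IsDeltaHyperbolic (GraphRealization Γ hΓ) δ) : FourPoint Γ.dist (2 * ⌊δ⌋₊ + 1) := by
  -- Points at the same distance `t` from `w` on `[w, a]` and `[w, b]` are close as long as `t` is
  -- at most the Gromov product of `a` and `b`.
  have key : ∀ (w a b : V) (p : Γ.Walk w a) (q : Γ.Walk w b), p.length = Γ.dist w a →
      q.length = Γ.dist w b → ∀ t : ℕ, t ≤ p.length → t ≤ q.length →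
      2 * t + Γ.dist a b ≤ Γ.dist w a + Γ.dist w b →
      Γ.dist (p.getVert t) (q.getVert t) ≤ ⌊δ⌋₊ := by
    intro w a b p q hp hq t htp htq ht
    obtain ⟨r, hr⟩ := hΓ.exists_walk_length_eq_dist a b
    have hthin := (h (realizedVertex hΓ w) (realizedVertex hΓ a) (realizedVertex hΓ b) _ _ _
      (r.isGeodesicSegment hr).1 (q.isGeodesicSegment hq).1.symm (p.isGeodesicSegment hp).1).1
    have hP := (p.dist_getVert_of_shortest hΓ hp htp).1
    have hQ := (q.dist_getVert_of_shortest hΓ hq htq).1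
    have := hthin _ ((p.isGeodesicSegment hp).2 t htp) _ ((q.isGeodesicSegment hq).2 t htq)
      (by rw [dist_realizedVertex, dist_realizedVertex, hP, hQ])
      (by
        unfold gromovProduct
        simp only [dist_realizedVertex, hP]
        have ht' : (2 * t + Γ.dist a b : ℝ) ≤ Γ.dist w a + Γ.dist w b := by exact_mod_cast ht
        linarith)
    rw [dist_realizedVertex] at this
    exact Nat.le_floor this
  intro w x y z
  obtain ⟨p, hp⟩ := hΓ.exists_walk_length_eq_dist w x
  obtain ⟨q, hq⟩ := hΓ.exists_walk_length_eq_dist w y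
  obtain ⟨r, hr⟩ := hΓ.exists_walk_length_eq_dist w z
  have txy := hΓ.dist_triangle (u := x) (v := w) (w := y)
  have tyz := hΓ.dist_triangle (u := y) (v := w) (w := z)
  have sx := SimpleGraph.dist_comm (G := Γ) (u := x) (v := w)
  have sy := SimpleGraph.dist_comm (G := Γ) (u := y) (v := w)
  have uy := hΓ.dist_triangle (u := w) (v := x) (w := y)
  have vy := hΓ.dist_triangle (u := w) (v := z) (w := y)
  have vz := hΓ.dist_triangle (u := w) (v := y) (w := z)
  have syz := SimpleGraph.dist_comm (G := Γ) (u := z) (v := y)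
  obtain ⟨t, ht⟩ : ∃ t, t = min (Γ.dist w x + Γ.dist w y - Γ.dist x y)
    (Γ.dist w y + Γ.dist w z - Γ.dist y z) / 2 := ⟨_, rfl⟩
  have k1 := key w x y p q hp hq t (by omega) (by omega) (by omega)
  have k2 := key w y z q r hq hr t (by omega) (by omega) (by omega)
  have hP := (p.dist_getVert_of_shortest hΓ hp (i := t) (by omega)).2
  have hR := (r.dist_getVert_of_shortest hΓ hr (i := t) (by omega)).2
  have t1 := hΓ.dist_triangle (u := x) (v := p.getVert t) (w := z)
  have t2 := hΓ.dist_triangle (u := p.getVert t) (v := q.getVert t) (w := z)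
  have t3 := hΓ.dist_triangle (u := q.getVert t) (v := r.getVert t) (w := z)
  have s1 := SimpleGraph.dist_comm (G := Γ) (u := x) (v := p.getVert t)
  omega

end Realization

/-! ### Word metrics -/

section WordMetric

variable {G : Type*} [Group G]

/-- The properties of the word metric of a finite generating set that the argument uses: a
left-invariant integer-valued pseudometric which has geodesics between any two points and finite
balls. -/
structure IsWordMetric (d : G → G → ℕ) : Prop where
  self : ∀ x, d x x = 0
  comm : ∀ x y, d x y = d y x
  triangle : ∀ x y z, d x z ≤ d x y + d y z
  mul_left : ∀ g x y, d (g * x) (g * y) = d x y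
  exists_between : ∀ x y t, t ≤ d x y → ∃ z, d x z = t ∧ d z y = d x y - t
  finite_ball : ∀ n, {x | d 1 x ≤ n}.Finite

theorem mulCayley_dist_mul_left_le {S : Set G} (hS : Subgroup.closure S = ⊤) (g x y : G) :
    (SimpleGraph.mulCayley S).dist (g * x) (g * y) ≤ (SimpleGraph.mulCayley S).dist x y := by
  obtain ⟨p, hp⟩ := (mulCayley_connected hS).exists_walk_length_eq_dist x y
  let f : SimpleGraph.mulCayley S →g SimpleGraph.mulCayley S :=
    ⟨fun a => g * a, fun h => SimpleGraph.mulCayley_adj_mul_iff_right.2 h⟩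
  have h := SimpleGraph.dist_le (p.map f)
  rw [SimpleGraph.Walk.length_map, hp] at h
  exact h

theorem isWordMetric_mulCayley {S : Set G} (hfin : S.Finite) (hS : Subgroup.closure S = ⊤) :
    IsWordMetric (SimpleGraph.mulCayley S).dist := by
  have hconn := mulCayley_connected hS
  have hbetween : ∀ x y t, t ≤ (SimpleGraph.mulCayley S).dist x y →
      ∃ z, (SimpleGraph.mulCayley S).dist x z = t ∧
        (SimpleGraph.mulCayley S).dist z y = (SimpleGraph.mulCayley S).dist x y - t := by
    intro x y t ht
    obtain ⟨p, hp⟩ := hconn.exists_walk_length_eq_dist x y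
    exact ⟨p.getVert t, p.dist_getVert_of_shortest hconn hp (ht.trans_eq hp.symm)⟩
  refine ⟨fun x => SimpleGraph.dist_self, fun x y => SimpleGraph.dist_comm,
    fun x y z => hconn.dist_triangle, ?_, hbetween, ?_⟩
  · intro g x y
    refine le_antisymm (mulCayley_dist_mul_left_le hS g x y) ?_
    simpa using mulCayley_dist_mul_left_le hS g⁻¹ (g * x) (g * y)
  · intro n
    induction n with
    | zero =>
      refine (Set.finite_singleton (1 : G)).subset fun x hx => ?_
      exact (hconn.dist_eq_zero_iff.1 (Nat.le_zero.1 hx)).symm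
    | succ n ih =>
      refine (ih.union (ih.mul (hfin.union hfin.inv))).subset fun x hx => ?_
      rcases Nat.le_or_eq_of_le_succ hx with h | h
      · exact Or.inl h
      · obtain ⟨z, hz1, hz2⟩ := hbetween 1 x n (by omega)
        have hadj : (SimpleGraph.mulCayley S).Adj z x :=
          SimpleGraph.dist_eq_one_iff_adj.1 (by omega)
        have hs := ((SimpleGraph.mulCayley_adj S z x).1 hadj).2
        refine Or.inr ⟨z, hz1.le, z⁻¹ * x, hs.imp id fun h => ?_, by simp⟩
        simpa using h

namespace IsWordMetric

variable {d d' : G → G → ℕ}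

theorem eq_one_inv_mul (hd : IsWordMetric d) (x y : G) : d x y = d 1 (x⁻¹ * y) := by
  simpa using (hd.mul_left x⁻¹ x y).symm

theorem one_inv (hd : IsWordMetric d) (x : G) : d 1 x⁻¹ = d 1 x := by
  rw [hd.comm, hd.eq_one_inv_mul, inv_inv, mul_one]

/-- Any two word metrics on a group are Lipschitz equivalent. -/
theorem exists_lipschitz (hd : IsWordMetric d) (hd' : IsWordMetric d') :
    ∃ L, ∀ x y, d' x y ≤ L * d x y + L := by
  obtain ⟨L, hL⟩ := ((hd.finite_ball 1).image (d' 1)).bddAbove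
  have hL1 : ∀ x y, d x y ≤ 1 → d' x y ≤ L := fun x y h => by
    rw [hd'.eq_one_inv_mul]
    exact hL ⟨_, by rwa [hd.eq_one_inv_mul] at h, rfl⟩
  refine ⟨L, fun x y => ?_⟩
  obtain ⟨n, hn⟩ : ∃ n, n = d x y := ⟨_, rfl⟩
  rw [← hn]
  induction n generalizing y with
  | zero => simpa using hL1 x y (by omega)
  | succ n ih =>
    obtain ⟨z, h1, h2⟩ := hd.exists_between x y n (by omega)
    have := ih z h1.symm
    have := hL1 z y (by omega)
    have := hd'.triangle x z y
    rw [Nat.mul_succ]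
    omega

end IsWordMetric

/-! ### Quasiconvexity of a subgroup in a hyperbolic word metric -/

/-- `A` has linear chains: any two points of `A` are joined inside `A` by a chain with steps of
bounded length, the number of steps being linear in the distance. -/
def HasLinearChains (d : G → G → ℕ) (A : Set G) : Prop :=
  ∃ L M, ∀ a ∈ A, ∀ b ∈ A, ∃ n, 1 ≤ n ∧ n ≤ L * (d a b + 1) ∧ ∃ x : ℕ → G,
    x 0 = a ∧ x n = b ∧ (∀ i, x i ∈ A) ∧ ∀ i < n, d (x i) (x (i + 1)) ≤ M

theorem hasLinearChains_of_isQuasiconvexSet {d : G → G → ℕ} (hd : IsWordMetric d) {T : Set G}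
    (hfin : T.Finite) (hT : Subgroup.closure T = ⊤) {ε : ℝ} {A : Set G}
    (hA : IsQuasiconvexSet ε (cayleyVertex T hT '' A)) : HasLinearChains d A := by
  classical
  obtain ⟨dT, hdT⟩ : ∃ dT, dT = (SimpleGraph.mulCayley T).dist := ⟨_, rfl⟩
  have hT' := isWordMetric_mulCayley hfin hT
  rw [← hdT] at hT'
  obtain ⟨L, hL⟩ := hd.exists_lipschitz hT'
  obtain ⟨M, hM⟩ := hT'.exists_lipschitz hd
  refine ⟨L + 1, M * (2 * ⌊ε⌋₊ + 1) + M, fun a ha b hb => ?_⟩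
  have hconn := mulCayley_connected hT
  obtain ⟨p, hp⟩ := hconn.exists_walk_length_eq_dist a b
  have hnear : ∀ i, ∃ u ∈ A, dT (p.getVert i) u ≤ ⌊ε⌋₊ ∧ (p.getVert i ∈ A → u = p.getVert i) := by
    intro i
    by_cases hi : p.getVert i ∈ A
    · exact ⟨_, hi, by rw [hT'.self]; exact Nat.zero_le _, fun _ => rfl⟩
    · have hlen : i ≤ p.length := by
        by_contra! h
        exact hi (by rwa [p.getVert_of_length_le h.le])
      obtain ⟨y, ⟨u, hu, rfl⟩, hy⟩ := hA _ ⟨a, ha, rfl⟩ _ ⟨b, hb, rfl⟩ _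
        (p.isGeodesicSegment (hΓ := hconn) hp).1 _ ((p.isGeodesicSegment (hΓ := hconn) hp).2 i hlen)
      refine ⟨u, hu, ?_, fun h => absurd h hi⟩
      have h' := (dist_realizedVertex (hΓ := hconn) (p.getVert i) u).symm.trans_le hy
      rw [hdT]
      exact Nat.le_floor h'
  choose x hxA hxd hxe using hnear
  have hlen : p.length ≤ L * d a b + L := by
    rw [hp, ← hdT]
    exact hL a b
  refine ⟨p.length + 1, by omega, by ring_nf; nlinarith, x, ?_, ?_, hxA, fun i _ => ?_⟩
  · rw [hxe 0 (by simpa using ha), p.getVert_zero]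
  · have : p.getVert (p.length + 1) = b := p.getVert_of_length_le (by omega)
    rw [hxe _ (by rwa [this]), this]
  · have h1 := p.dist_getVert_le hconn (Nat.le_succ i)
    rw [← hdT, Nat.succ_eq_add_one, Nat.add_sub_cancel_left] at h1
    have h2 := hT'.triangle (x i) (p.getVert i) (x (i + 1))
    have h3 := hT'.triangle (p.getVert i) (p.getVert (i + 1)) (x (i + 1))
    have h4 := hxd i
    have h5 := hxd (i + 1)
    rw [hT'.comm] at h4
    refine (hM _ _).trans (Nat.add_le_add_right (Nat.mul_le_mul_left M ?_) M)
    omega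

/-- Exponential divergence: if consecutive points of a chain of at most `2 ^ k` steps have Gromov
products at least `r` with respect to `p`, then the ends of the chain have Gromov product at least
`r - k * δ / 2`. -/
theorem FourPoint.chain {X : Type*} {d : X → X → ℕ} {δ : ℕ} (h : FourPoint d δ) (p : X)
    (r k n : ℕ) (hn : 1 ≤ n) (hnk : n ≤ 2 ^ k) (x : ℕ → X)
    (hx : ∀ i < n, d (x i) (x (i + 1)) + 2 * r ≤ d p (x i) + d p (x (i + 1))) :
    d (x 0) (x n) + 2 * r ≤ d p (x 0) + d p (x n) + k * δ := by
  induction k generalizing n x with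
  | zero =>
    obtain rfl : n = 1 := by simp at hnk; omega
    simpa using hx 0 (by omega)
  | succ k ih =>
    rw [pow_succ] at hnk
    by_cases hle : n ≤ 2 ^ k
    · have := ih n hn hle x hx
      rw [Nat.add_one_mul k δ]
      omega
    · have a := ih (2 ^ k) Nat.one_le_two_pow le_rfl x fun i hi => hx i (by omega)
      have b := ih (n - 2 ^ k) (by omega) (by omega) (fun i => x (2 ^ k + i)) fun i hi => by
        simpa [add_assoc] using hx (2 ^ k + i) (by omega)
      simp only [add_zero, Nat.add_sub_cancel' (le_of_not_ge hle)] at b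
      have c := h p (x 0) (x (2 ^ k)) (x n)
      rw [Nat.add_one_mul k δ]
      omega

theorem exists_two_pow_ge (A : ℕ) : ∃ K, ∀ k ≥ K, A * (k + 1) ≤ 2 ^ k := by
  refine ⟨4 * A, fun k hk => ?_⟩
  have h1 : k / 2 < 2 ^ (k / 2) := Nat.lt_two_pow_self
  have h2 : k - k / 2 < 2 ^ (k - k / 2) := Nat.lt_two_pow_self
  have h3 : 2 ^ k = 2 ^ (k / 2) * 2 ^ (k - k / 2) := by
    rw [← pow_add]
    congr 1
    omega
  rw [h3]
  have h4 : (k / 2 + 1) * (k - k / 2 + 1) ≤ 2 ^ (k / 2) * 2 ^ (k - k / 2) :=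
    Nat.mul_le_mul h1 h2
  have h5 : 2 * A * (k - k / 2 + 1) ≤ (k / 2 + 1) * (k - k / 2 + 1) :=
    Nat.mul_le_mul_right _ (by omega)
  have h6 : A * (k + 1) ≤ A * (2 * (k - k / 2 + 1)) := Nat.mul_le_mul_left _ (by omega)
  linarith

theorem exists_log_bound (L M δ : ℕ) :
    ∃ R, ∀ D > R, ∃ k, L * (6 * D + 1) ≤ 2 ^ k ∧ 2 * M + (k + 2) * δ < 2 * D := by
  obtain ⟨K, hK⟩ := exists_two_pow_ge (L * (6 * (δ + 1) + 1))
  refine ⟨(δ + 1) * K + 2 * M + 2 * δ, fun D hD => ⟨D / (δ + 1), ?_, ?_⟩⟩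
  · refine le_trans ?_ (hK (D / (δ + 1)) ?_)
    · rw [mul_assoc]
      refine Nat.mul_le_mul_left _ ?_
      have := Nat.lt_mul_div_succ D (Nat.succ_pos δ)
      simp only [Nat.succ_eq_add_one] at this
      nlinarith
    · refine (Nat.le_div_iff_mul_le (Nat.succ_pos δ)).2 ?_
      rw [mul_comm]
      simp only [Nat.succ_eq_add_one]
      omega
  · have h1 := Nat.div_mul_le_self D (δ + 1)
    generalize D / (δ + 1) = m at h1 ⊢
    rw [Nat.mul_add_one] at h1
    rw [Nat.add_mul m]
    omega

theorem exists_nearest {X : Type*} (d : X → X → ℕ) {A : Set X} (hA : A.Nonempty) (p : X) :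
    ∃ a ∈ A, ∀ a' ∈ A, d p a ≤ d p a' := by
  obtain ⟨a, ha, h⟩ := WellFounded.has_min (measure (d p)).wf A hA
  exact ⟨a, ha, fun a' ha' => not_lt.1 (h a' ha')⟩

/-- In a hyperbolic word metric, a set with linear chains is quasiconvex. At a point `p` of a
geodesic that is farthest from the set, at distance `D`, the chain between the projections of two
points of the geodesic on both sides of `p` has length linear in `D` and stays at distance `D`
from `p`, whereas by divergence such a chain needs exponentially many steps. -/
theorem exists_quasiconvexity_constant {d : G → G → ℕ} {δ : ℕ} (hd : IsWordMetric d)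
    (h : FourPoint d δ) {A : Set G} (hA : HasLinearChains d A) :
    ∃ R, ∀ a ∈ A, ∀ b ∈ A, ∀ p, d a p + d p b = d a b → ∃ u ∈ A, d p u ≤ R := by
  obtain ⟨L, M, hLM⟩ := hA
  obtain ⟨R, hR⟩ := exists_log_bound L M δ
  refine ⟨R, fun a ha b hb => ?_⟩
  by_contra! hcon
  obtain ⟨q, hq, hqR⟩ := hcon
  choose π hπA hπ using exists_nearest d ⟨a, ha⟩
  obtain ⟨p, hp, hmax⟩ : ∃ p, d a p + d p b = d a b ∧
      ∀ y, d a y + d y b = d a b → d y (π y) ≤ d p (π p) := by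
    have hbdd : BddAbove ((fun y => d y (π y)) '' {y | d a y + d y b = d a b}) := by
      refine ⟨d a b, ?_⟩
      rintro _ ⟨y, hy, rfl⟩
      have := hπ y a ha
      rw [hd.comm y a] at this
      have hy' : d a y + d y b = d a b := hy
      simp only
      omega
    obtain ⟨p, hp, hpm⟩ := Nat.sSup_mem (Set.Nonempty.image _ ⟨q, hq⟩) hbdd
    exact ⟨p, hp, fun y hy => (le_csSup hbdd ⟨y, hy, rfl⟩).trans_eq hpm.symm⟩
  obtain ⟨D, hD⟩ : ∃ D, D = d p (π p) := ⟨_, rfl⟩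
  have hDR : R < D := by
    have h1 := hqR (π q) (hπA q)
    have h2 := hmax q hq
    omega
  have hDle : ∀ u ∈ A, D ≤ d p u := fun u hu => hD.trans_le (hπ p u hu)
  -- The same construction serves for both ends of the geodesic.
  have hside : ∀ c ∈ A, ∀ e, d c p + d p e = d c e → (∀ y, d c y + d y e = d c e →
      d y (π y) ≤ D) → ∃ y, ∃ y' ∈ A, d c y + d y p = d c p ∧ d y p ≤ 2 * D ∧ d y y' ≤ D ∧
        d y y' + 2 * D ≤ d y p + d p y' := by
    intro c hc e hce hm
    by_cases hs : d c p ≤ 2 * D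
    · refine ⟨c, c, hc, by rw [hd.self]; omega, hs, by rw [hd.self]; omega, ?_⟩
      have := hDle c hc
      rw [hd.self, hd.comm c p]
      omega
    · obtain ⟨y, hy1, hy2⟩ := hd.exists_between c p (d c p - 2 * D) (by omega)
      have hye : d c y + d y e = d c e := by
        have := hd.triangle y p e
        have := hd.triangle c y e
        omega
      have h1 := hm y hye
      have h2 := hDle _ (hπA y)
      exact ⟨y, π y, hπA y, by omega, by omega, h1, by omega⟩
  obtain ⟨y, y', hy', hy1, hy2, hy3, hy4⟩ := hside a ha b hp fun y hy => hD ▸ hmax y hy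
  obtain ⟨z, z', hz', hz1, hz2, hz3, hz4⟩ := hside b hb a
    (by rw [hd.comm b p, hd.comm p a, hd.comm b a]; omega)
    fun y hy => hD ▸ hmax y (by rw [hd.comm b y, hd.comm y a, hd.comm b a] at hy; omega)
  have hyz : d y p + d p z ≤ d y z := by
    have := hd.triangle a y b
    have := hd.triangle y z b
    have := hd.comm z b
    have := hd.comm p b
    have := hd.comm z p
    omega
  obtain ⟨k, hk1, hk2⟩ := hR D hDR
  obtain ⟨n, hn1, hn2, x, hx0, hxn, hxA, hxM⟩ := hLM y' hy' z' hz'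
  have hdist : d y' z' ≤ 6 * D := by
    have := hd.triangle y' y z'
    have := hd.triangle y z z'
    have := hd.triangle y p z
    have := hd.comm y' y
    have := hd.comm z p
    omega
  have hnk : n ≤ 2 ^ k := (hn2.trans (Nat.mul_le_mul_left L (by omega))).trans hk1
  have hMD : M ≤ D := by
    omega
  have hchain := h.chain p (D - M) k n hn1 hnk x fun i hi => by
    have := hxM i hi
    have := hDle _ (hxA i)
    have := hDle _ (hxA (i + 1))
    omega
  rw [hx0, hxn] at hchain
  have f1 := h p y y' z'
  have f2 := h p y z' z
  have := hd.comm z' z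
  have := hd.comm y p
  have := hd.comm z p
  have e : (k + 2) * δ = k * δ + 2 * δ := by ring
  omega

theorem exists_near_of_gromovProduct_le {d : G → G → ℕ} {δ R : ℕ} (hd : IsWordMetric d)
    (h : FourPoint d δ) {A : Set G}
    (hR : ∀ a ∈ A, ∀ b ∈ A, ∀ p, d a p + d p b = d a b → ∃ u ∈ A, d p u ≤ R)
    {a b : G} (ha : a ∈ A) (hb : b ∈ A) {p : G} {c : ℕ} (hp : d p a + d p b ≤ d a b + c) :
    ∃ u ∈ A, d p u ≤ R + c + δ + 1 := by
  have t1 := hd.triangle p b a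
  have c1 := hd.comm a b
  have c2 := hd.comm a p
  obtain ⟨q, hq1, hq2⟩ := hd.exists_between a b ((d a b + d p a - d p b) / 2) (by omega)
  obtain ⟨u, hu, hqu⟩ := hR a ha b hb q (by omega)
  have f := h a p b q
  have c4 := hd.comm q b
  have t4 := hd.triangle p q u
  exact ⟨u, hu, by omega⟩

end WordMetric

/-! ### Quasimorphisms and cyclic subgroups of finite index -/

/-- A group with a proper quasimorphism to `ℤ` is finite or virtually infinite cyclic. -/
theorem exists_finiteIndex_zpowers_of_quasimorphism {Q : Type*} [Group Q] (β : Q → ℤ) (D : ℤ)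
    (hβ : ∀ f g, |β (f * g) - β f - β g| ≤ D) (hfin : ∀ A : ℤ, {f | |β f| ≤ A}.Finite) :
    ∃ f : Q, (Subgroup.zpowers f).FiniteIndex := by
  by_cases hb : ∀ f, |β f| ≤ 3 * D
  · have : Finite Q := Set.finite_univ_iff.1 ((hfin (3 * D)).subset fun f _ => hb f)
    exact ⟨1, inferInstance⟩
  push Not at hb
  obtain ⟨f, hf⟩ := hb
  refine ⟨f, ?_⟩
  have h1 : |β 1| ≤ D := by
    have := hβ 1 1
    rw [one_mul, sub_self, zero_sub, abs_neg] at this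
    exact this
  have hinv : |β 1 - β f - β f⁻¹| ≤ D := by simpa using hβ f f⁻¹
  -- In each coset of `⟨f⟩`, a representative with the smallest `|β|` has a bounded `|β|`, as one
  -- of the multiplications by `f` and `f⁻¹` moves a large `β` towards `0`.
  have hrep : ∀ h : Q, ∃ n : ℤ, |β (h * f ^ n)| ≤ |β f| + 4 * D := by
    intro h
    obtain ⟨m, ⟨n, hn⟩, hmin⟩ : ∃ m : ℕ, (∃ n : ℤ, (β (h * f ^ n)).natAbs = m) ∧
        ∀ n : ℤ, m ≤ (β (h * f ^ n)).natAbs := by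
      classical
      have hex : ∃ m : ℕ, ∃ n : ℤ, (β (h * f ^ n)).natAbs = m := ⟨_, 0, rfl⟩
      exact ⟨Nat.find hex, Nat.find_spec hex, fun n => Nat.find_min' hex ⟨n, rfl⟩⟩
    refine ⟨n, ?_⟩
    by_contra! hlt
    have a1 := hβ (h * f ^ n) f
    have a2 := hβ (h * f ^ n) f⁻¹
    have b1 := hmin (n + 1)
    have b2 := hmin (n - 1)
    rw [zpow_add_one, ← mul_assoc] at b1
    rw [zpow_sub_one, ← mul_assoc] at b2
    simp only [abs_le, lt_abs] at *
    rcases abs_cases (β f) with hc | hc <;> omega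
  have hsurj : Set.SurjOn (fun e : Q => (e : Q ⧸ Subgroup.zpowers f))
      {e | |β e| ≤ |β f| + 4 * D} Set.univ := by
    intro x _
    obtain ⟨h, rfl⟩ := QuotientGroup.mk_surjective x
    obtain ⟨n, hn⟩ := hrep h
    refine ⟨h * f ^ n, hn, ?_⟩
    rw [QuotientGroup.eq]
    exact ⟨-n, by simp⟩
  have := Set.finite_univ_iff.1 (Set.Finite.of_surjOn _ hsurj (hfin _))
  exact Subgroup.finiteIndex_of_finite_quotient

/-! ### Elements with a bounded Gromov product of `x` and `x⁻¹` -/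

section

variable {G : Type*} [Group G] {d : G → G → ℕ} {δ : ℕ}

/-- The orbit of an element `x` that is long compared with the Gromov product of `x` and `x⁻¹` is a
local quasigeodesic, hence it moves away from `1` at each step. -/
theorem IsWordMetric.pow_length (hd : IsWordMetric d) (h : FourPoint d δ) {x : G} {c : ℕ}
    (hx : 2 * d 1 x ≤ d 1 (x * x) + c) (hlen : c + δ < d 1 x) (n : ℕ) :
    d 1 (x ^ n) + d 1 x ≤ d 1 (x ^ (n + 1)) + c + δ := by
  induction n with
  | zero =>
    rw [pow_zero, zero_add, pow_one, hd.self]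
    omega
  | succ n ih =>
    have f := h (x ^ (n + 1)) (x ^ n) 1 (x ^ (n + 2))
    have e1 : d (x ^ n) (x ^ (n + 2)) = d 1 (x * x) := by
      rw [hd.eq_one_inv_mul, pow_add, pow_two, inv_mul_cancel_left]
    have e2 : d (x ^ (n + 1)) (x ^ (n + 2)) = d 1 x := by
      rw [hd.eq_one_inv_mul, pow_succ x (n + 1), inv_mul_cancel_left]
    have e3 : d (x ^ (n + 1)) (x ^ n) = d 1 x := by
      rw [hd.comm, hd.eq_one_inv_mul, pow_succ, inv_mul_cancel_left]
    have e4 := hd.comm (x ^ n) 1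
    have e5 := hd.comm (x ^ (n + 1)) 1
    have e6 : d 1 (x ^ (n + 1 + 1)) = d 1 (x ^ (n + 2)) := rfl
    omega

theorem IsWordMetric.le_pow_length (hd : IsWordMetric d) (h : FourPoint d δ) {x : G} {c : ℕ}
    (hx : 2 * d 1 x ≤ d 1 (x * x) + c) (hlen : c + δ < d 1 x) (n : ℕ) : n ≤ d 1 (x ^ n) := by
  induction n with
  | zero => exact Nat.zero_le _
  | succ n ih =>
    have := hd.pow_length h hx hlen n
    omega

theorem IsWordMetric.pow_mul_pow_length (hd : IsWordMetric d) (h : FourPoint d δ) {x : G} {c : ℕ}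
    (hx : 2 * d 1 x ≤ d 1 (x * x) + c) (hlen : c + 2 * δ < d 1 x) (m n : ℕ) :
    d 1 (x ^ m) + d 1 (x ^ n) ≤ d 1 (x ^ (m + n)) + c + 2 * δ := by
  rcases Nat.eq_zero_or_pos n with rfl | hn
  · rw [add_zero, pow_zero, hd.self]
    omega
  obtain ⟨n, rfl⟩ : ∃ k, n = k + 1 := ⟨n - 1, by omega⟩
  have hlen' : c + δ < d 1 x := by omega
  have f := h 1 (x ^ m)⁻¹ (x ^ (n + 1)) x
  have a := hd.pow_length h hx hlen' m
  have b := hd.pow_length h hx hlen' n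
  have e1 : d (x ^ m)⁻¹ x = d 1 (x ^ (m + 1)) := by
    rw [hd.eq_one_inv_mul, inv_inv, pow_succ]
  have e2 : d (x ^ m)⁻¹ (x ^ (n + 1)) = d 1 (x ^ (m + (n + 1))) := by
    rw [hd.eq_one_inv_mul, inv_inv, ← pow_add]
  have e3 : d (x ^ (n + 1)) x = d 1 (x ^ n) := by
    rw [hd.comm, hd.eq_one_inv_mul, pow_succ', inv_mul_cancel_left]
  have e4 := hd.one_inv (x ^ m)
  omega

/-- If an element `x` that is long compared with the Gromov product of `x` and `x⁻¹` is conjugate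
into a quasiconvex subgroup `H`, then a conjugator of bounded length will do: the coset
`g H` contains `x ^ n * g` for all integers `n`, hence passes near `1`. -/
theorem exists_short_conjugator {R : ℕ} (hd : IsWordMetric d) (h : FourPoint d δ) {H : Subgroup G}
    (hR : ∀ a ∈ H, ∀ b ∈ H, ∀ p, d a p + d p b = d a b → ∃ u ∈ H, d p u ≤ R) {x : G} {c : ℕ}
    (hx : 2 * d 1 x ≤ d 1 (x * x) + c) (hlen : c + 2 * δ < d 1 x)
    (hconj : ∃ g : G, g⁻¹ * x * g ∈ H) :
    ∃ r : G, d 1 r ≤ R + c + 5 * δ + 1 ∧ r⁻¹ * x * r ∈ H := by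
  obtain ⟨g, hg⟩ := hconj
  have hpow : ∀ n : ℕ, g⁻¹ * x ^ n * g ∈ H := fun n => by
    have := H.pow_mem hg n
    rwa [show (g⁻¹ * x * g) ^ n = g⁻¹ * x ^ n * g by
      simpa using (conj_pow (a := g⁻¹) (b := x) (i := n))] at this
  have hpow' : ∀ n : ℕ, g⁻¹ * (x ^ n)⁻¹ * g ∈ H := fun n => by
    have := H.inv_mem (hpow n)
    simpa [mul_assoc] using this
  -- For this `n`, the length of `x ^ n` dominates that of `g`.
  obtain ⟨n, hn⟩ : ∃ n, n = 2 * d 1 g + c + 4 * δ + 1 := ⟨_, rfl⟩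
  have hlen1 := hd.le_pow_length h hx (by omega) n
  have hlen2 := hd.pow_mul_pow_length h hx hlen n n
  have e1 : d (x ^ n)⁻¹ (x ^ n) = d 1 (x ^ (n + n)) := by
    rw [hd.eq_one_inv_mul, inv_inv, ← pow_add]
  have e2 : d (x ^ n) (x ^ n * g) = d 1 g := by
    rw [hd.eq_one_inv_mul, inv_mul_cancel_left]
  have e3 : d (x ^ n)⁻¹ ((x ^ n)⁻¹ * g) = d 1 g := by
    rw [hd.eq_one_inv_mul, inv_mul_cancel_left]
  have e4 : d g⁻¹ (g⁻¹ * (x ^ n)⁻¹ * g) = d 1 ((x ^ n)⁻¹ * g) := by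
    rw [hd.eq_one_inv_mul]
    group
  have e5 : d g⁻¹ (g⁻¹ * x ^ n * g) = d 1 (x ^ n * g) := by
    rw [hd.eq_one_inv_mul]
    group
  have e6 : d (g⁻¹ * (x ^ n)⁻¹ * g) (g⁻¹ * x ^ n * g) = d ((x ^ n)⁻¹ * g) (x ^ n * g) := by
    rw [mul_assoc, mul_assoc, hd.mul_left]
  have e7 := hd.one_inv (x ^ n)
  have f1 := h 1 (x ^ n)⁻¹ ((x ^ n)⁻¹ * g) (x ^ n)
  have f2 := h 1 ((x ^ n)⁻¹ * g) (x ^ n * g) (x ^ n)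
  have c1 := hd.comm (x ^ n) (x ^ n * g)
  obtain ⟨u, hu, hgu⟩ := exists_near_of_gromovProduct_le hd h (A := (H : Set G)) hR (hpow' n)
    (hpow n) (p := g⁻¹) (c := c + 4 * δ) (by rw [e4, e5, e6]; omega)
  refine ⟨g * u, ?_, ?_⟩
  · rw [hd.eq_one_inv_mul, inv_inv] at hgu
    omega
  · have := H.mul_mem (H.mul_mem (H.inv_mem hu) hg) hu
    convert this using 1
    group

open scoped Pointwise in
/-- If every element of `H₂` becomes, after multiplication by a bounded element `f` of `H₂`, an
element with bounded Gromov product with its inverse, then `H₂` is a finite union of cosets of its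
intersections with conjugates of `H₁`, and B. H. Neumann's lemma applies. -/
theorem exists_finiteIndex_of_bounded_correction {R N c : ℕ} (hd : IsWordMetric d)
    (h : FourPoint d δ) {H₁ H₂ : Subgroup G}
    (hR : ∀ a ∈ H₁, ∀ b ∈ H₁, ∀ p, d a p + d p b = d a b → ∃ u ∈ H₁, d p u ≤ R)
    (hconj : IsElementwiseConjugateInto H₂ H₁)
    (hN : ∀ x ∈ H₂, ∃ f ∈ H₂, d 1 f ≤ N ∧ 2 * d 1 (f * x) ≤ d 1 (f * x * (f * x)) + c) :
    ∃ K : Subgroup G, K ≤ H₂ ∧ (K.subgroupOf H₂).FiniteIndex ∧ IsConjugateInto K H₁ := by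
  classical
  let C : G → Subgroup G := fun r => H₁.comap (MulAut.conj r⁻¹).toMonoidHom
  have hC : ∀ r x, x ∈ C r ↔ r⁻¹ * x * r ∈ H₁ := fun r x => by
    simp [C, Subgroup.mem_comap]
  have hfin : {i : G × H₂ | d 1 i.1 ≤ R + c + 5 * δ + 1 ∧ d 1 (i.2 : G) ≤ N + c + 2 * δ}.Finite :=
    (hd.finite_ball _).prod ((hd.finite_ball _).preimage Subtype.val_injective.injOn)
  have hcover : ⋃ i ∈ hfin.toFinset, i.2 • (((C i.1).subgroupOf H₂ : Subgroup H₂) : Set H₂) =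
      Set.univ := by
    refine Set.eq_univ_of_forall fun x => ?_
    simp only [Set.mem_iUnion, Set.Finite.mem_toFinset, Set.mem_ofPred_eq, mem_leftCoset_iff,
      SetLike.mem_coe, Subgroup.mem_subgroupOf, hC]
    obtain ⟨f, hf, hfN, hfx⟩ := hN x x.2
    by_cases hlen : c + 2 * δ < d 1 (f * x)
    · obtain ⟨r, hr1, hr2⟩ := exists_short_conjugator hd h hR hfx hlen
        (hconj _ (H₂.mul_mem hf x.2))
      refine ⟨(r, ⟨f, hf⟩⁻¹), ⟨hr1, ?_⟩, by simpa using hr2⟩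
      have := hd.one_inv f
      simp only [InvMemClass.coe_inv]
      omega
    · refine ⟨(1, x), ⟨by rw [hd.self]; exact Nat.zero_le _, ?_⟩, by simp⟩
      have e1 := hd.mul_left f 1 x
      rw [mul_one] at e1
      have e2 := hd.triangle f 1 (f * x)
      have e3 := hd.comm f 1
      simp only
      omega
  obtain ⟨i, -, hi⟩ := Subgroup.exists_finiteIndex_of_leftCoset_cover hcover
  exact ⟨C i.1 ⊓ H₂, inf_le_right, by rwa [Subgroup.inf_subgroupOf_right],
    i.1, fun a ha => (hC _ _).1 ha.1⟩

/-! ### Subgroups that almost fix a point at infinity -/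

/-- The change of the distance to `1` under the action of `f` on `p`; for `p` tending to a point
at infinity, this is a value of a Busemann function. -/
def busemannShift (d : G → G → ℕ) (p f : G) : ℤ :=
  (d 1 (f * p) : ℤ) - d 1 p

theorem abs_busemannShift_le (hd : IsWordMetric d) (p f : G) :
    |busemannShift d p f| ≤ d 1 f := by
  have e1 := hd.mul_left f 1 p
  rw [mul_one] at e1
  have e2 := hd.triangle f 1 (f * p)
  have e3 := hd.triangle 1 f (f * p)
  have e4 := hd.comm f 1
  unfold busemannShift
  rw [abs_le]
  omega

/-- On elements that almost fix the direction of `p`, the shift is a quasimorphism. -/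
theorem abs_busemannShift_mul_le (hd : IsWordMetric d) (h : FourPoint d δ) {p f g : G} {M : ℕ}
    (hg : d (g * p) p + M ≤ d 1 (g * p) + d 1 p) (hM : 2 * d 1 f + δ < M) :
    |busemannShift d p (f * g) - busemannShift d p f - busemannShift d p g| ≤ δ := by
  have e1 : d f⁻¹ (g * p) = d 1 (f * g * p) := by
    rw [hd.eq_one_inv_mul, inv_inv, mul_assoc]
  have e2 : d f⁻¹ p = d 1 (f * p) := by
    rw [hd.eq_one_inv_mul, inv_inv]
  have f1 := h 1 f⁻¹ (g * p) p
  have f2 := h 1 f⁻¹ p (g * p)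
  have e3 := hd.comm (g * p) p
  have e4 := hd.one_inv f
  have t2 := hd.triangle 1 f⁻¹ p
  unfold busemannShift
  rw [abs_le]
  omega

/-- An element that almost fixes the direction of `p` and has a small shift moves a point `q` of
the geodesic from `1` to `p` by a bounded amount. -/
theorem dist_mul_le_of_busemannShift (hd : IsWordMetric d) (h : FourPoint d δ) {p f q : G}
    {k A : ℕ} (hf : d (f * p) p + 2 * k ≤ d 1 (f * p) + d 1 p) (hk : 2 * d 1 f + 2 * δ < k)
    (hA : |busemannShift d p f| ≤ A) (hq1 : d 1 q = k) (hq2 : d q p = d 1 p - k) :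
    d q (f * q) ≤ A + 3 * δ := by
  have hp : k ≤ d 1 p := by
    have := hd.triangle 1 p (f * p)
    have := hd.comm (f * p) p
    omega
  have e1 : d f⁻¹ q = d 1 (f * q) := by
    rw [hd.eq_one_inv_mul, inv_inv]
  have e2 : d f⁻¹ p = d 1 (f * p) := by
    rw [hd.eq_one_inv_mul, inv_inv]
  have e3 := hd.mul_left f q p
  have e4 := hd.one_inv f
  have c1 := hd.comm q p
  have c2 := hd.comm p (f * p)
  have c3 := hd.comm (f * q) (f * p)
  -- The shift of `q` agrees with that of `p` up to `δ`.
  have s1 : d 1 (f * q) + d 1 p ≤ d 1 (f * p) + k + δ := by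
    have f1 := h 1 f⁻¹ p q
    omega
  have s2 : d q (f * p) + k ≤ d 1 (f * p) + δ := by
    have f2 := h 1 q p (f * p)
    omega
  have f3 := h 1 q (f * p) (f * q)
  unfold busemannShift at hA
  rw [abs_le] at hA
  omega

/-- If no bounded correction makes the Gromov products of all elements of `H` with their inverses
bounded, then `H` almost fixes directions of arbitrarily far points. -/
theorem exists_almost_fixed_direction (hd : IsWordMetric d) (h : FourPoint d δ) {H : Subgroup G}
    (hbad : ∀ N c : ℕ, ∃ x ∈ H, ∀ f ∈ H, d 1 f ≤ N →
      d 1 (f * x * (f * x)) + c < 2 * d 1 (f * x)) (N M : ℕ) :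
    ∃ p, ∀ f ∈ H, d 1 f ≤ N → d (f * p) p + M ≤ d 1 (f * p) + d 1 p := by
  obtain ⟨p, -, hp⟩ := hbad N (M + 2 * N + 2 * δ)
  refine ⟨p, fun f hf hfN => ?_⟩
  have a := hp f hf hfN
  have b := hp 1 H.one_mem (by rw [hd.self]; exact Nat.zero_le _)
  rw [one_mul] at b
  have e1 : d (f * p)⁻¹ (f * p) = d 1 (f * p * (f * p)) := by
    rw [hd.eq_one_inv_mul, inv_inv]
  have e2 : d p⁻¹ p = d 1 (p * p) := by
    rw [hd.eq_one_inv_mul, inv_inv]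
  have e3 : d (f * p)⁻¹ p⁻¹ = d 1 f := by
    rw [hd.eq_one_inv_mul]
    simp
  have e4 := hd.one_inv (f * p)
  have e5 := hd.one_inv p
  have f1 := h 1 (f * p) (f * p)⁻¹ p⁻¹
  have f2 := h 1 (f * p) p⁻¹ p
  have c1 := hd.comm (f * p) (f * p)⁻¹
  omega

/-- A subgroup that almost fixes directions of arbitrarily far points has a cyclic subgroup of
finite index: the shifts converge along an ultrafilter to a proper quasimorphism. -/
theorem exists_finiteIndex_zpowers_of_almost_fixed (hd : IsWordMetric d) (h : FourPoint d δ)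
    {H : Subgroup G} (hfix : ∀ N M : ℕ, ∃ p, ∀ f ∈ H, d 1 f ≤ N →
      d (f * p) p + M ≤ d 1 (f * p) + d 1 p) :
    ∃ f : H, (Subgroup.zpowers f).FiniteIndex := by
  choose p hp using fun N : ℕ => hfix N (2 * (2 * N + 2 * δ + 1))
  have hlim : ∀ f : H, ∃ b : ℤ, ∀ᶠ N in (Filter.hyperfilter ℕ : Filter ℕ),
      busemannShift d (p N) f = b := by
    intro f
    have h1 := (Ultrafilter.eventually_exists_mem_iff (f := Filter.hyperfilter ℕ)
      (P := fun (b : ℤ) N => busemannShift d (p N) f = b)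
      (Set.finite_Icc (-(d 1 (f : G)) : ℤ) (d 1 (f : G)))).1
      (Filter.Eventually.of_forall fun N =>
        ⟨_, abs_le.1 (abs_busemannShift_le hd (p N) f), rfl⟩)
    obtain ⟨b, -, hb⟩ := h1
    exact ⟨b, hb⟩
  choose β hβ using hlim
  have hlarge : ∀ f : G, ∀ᶠ N in (Filter.hyperfilter ℕ : Filter ℕ), d 1 f ≤ N := fun f =>
    (Filter.eventually_ge_atTop (d 1 f)).filter_mono Nat.hyperfilter_le_atTop
  refine exists_finiteIndex_zpowers_of_quasimorphism β δ (fun f g => ?_) fun A => ?_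
  · obtain ⟨N, h1, h2, h3, h4, h5⟩ := ((hβ f).and ((hβ g).and ((hβ (f * g)).and
      ((hlarge f).and (hlarge g))))).exists
    rw [← h1, ← h2, ← h3]
    exact abs_busemannShift_mul_le hd h (hp N g g.2 h5) (by omega)
  · rcases lt_or_ge A 0 with hA | hA
    · convert Set.finite_empty using 1
      exact Set.eq_empty_of_forall_notMem fun f hf =>
        hA.not_ge ((abs_nonneg (β f)).trans hf)
    lift A to ℕ using hA
    by_contra hinf
    obtain ⟨B, hB⟩ : ∃ B, B = (hd.finite_ball (A + 3 * δ)).toFinset := ⟨_, rfl⟩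
    obtain ⟨T, hT, hcard⟩ := Set.Infinite.exists_subset_card_eq hinf (B.card + 1)
    have hev : ∀ᶠ N in (Filter.hyperfilter ℕ : Filter ℕ), ∀ f ∈ T,
        busemannShift d (p N) f = β f ∧ d 1 (f : G) ≤ N :=
      (Filter.eventually_all_finset T).2 fun f _ => (hβ f).and (hlarge f)
    obtain ⟨N, hN⟩ := hev.exists
    have hlen : 2 * N + 2 * δ + 1 ≤ d 1 (p N) := by
      have := hp N 1 H.one_mem (by rw [hd.self]; exact Nat.zero_le _)
      rw [one_mul, hd.self] at this
      omega
    obtain ⟨q, hq1, hq2⟩ := hd.exists_between 1 (p N) _ hlen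
    -- Conjugation by `q` maps `T` injectively into a ball that does not depend on `T`.
    have hmaps : ∀ f ∈ T, q⁻¹ * f * q ∈ B := fun f hf => by
      have := dist_mul_le_of_busemannShift hd h (hp N f f.2 (hN f hf).2)
        (by have := (hN f hf).2; omega) (by rw [(hN f hf).1]; exact hT hf) hq1 hq2
      rw [hd.eq_one_inv_mul, ← mul_assoc] at this
      rw [hB]
      simpa using this
    have := Finset.card_le_card_of_injOn (fun f : H => q⁻¹ * f * q) hmaps
      fun f _ g _ hfg => by simpa using hfg
    omega

end

/-! ### Elementwise conjugacy into a quasiconvex subgroup -/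

theorem theoremA {G : Type*} [Group G] (hG : IsHyperbolicGroup G)
    (H₁ H₂ : Subgroup G) (hH₁ : IsQuasiconvexSubgroup H₁)
    (hconj : IsElementwiseConjugateInto H₂ H₁) :
    ∃ K : Subgroup G, K ≤ H₂ ∧ (K.subgroupOf H₂).FiniteIndex ∧ IsConjugateInto K H₁ := by
  obtain ⟨S, hSfin, hS, δ, -, hδ⟩ := hG
  obtain ⟨T, hTfin, hT, ε, -, hε⟩ := hH₁
  have hd := isWordMetric_mulCayley hSfin hS
  have h := fourPoint_of_isDeltaHyperbolic hδ
  obtain ⟨R, hR⟩ := exists_quasiconvexity_constant hd h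
    (hasLinearChains_of_isQuasiconvexSet hd hTfin hT hε)
  generalize (SimpleGraph.mulCayley S).dist = d at hd h hR
  by_cases hN : ∃ N c : ℕ, ∀ x ∈ H₂, ∃ f ∈ H₂, d 1 f ≤ N ∧
      2 * d 1 (f * x) ≤ d 1 (f * x * (f * x)) + c
  · obtain ⟨N, c, hN⟩ := hN
    exact exists_finiteIndex_of_bounded_correction hd h hR hconj hN
  · push Not at hN
    obtain ⟨f, hf⟩ := exists_finiteIndex_zpowers_of_almost_fixed hd h
      (exists_almost_fixed_direction hd h hN)
    obtain ⟨c, hc⟩ := hconj f f.2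
    refine ⟨Subgroup.zpowers (f : G), by simp, ?_, c, ?_⟩
    · have e : (Subgroup.zpowers (f : G)).subgroupOf H₂ = Subgroup.zpowers f := by
        ext x
        simp [Subgroup.mem_subgroupOf, Subgroup.mem_zpowers_iff, Subtype.ext_iff]
      rwa [e]
    · rintro a ⟨n, rfl⟩
      have := H₁.zpow_mem hc n
      have e : (c⁻¹ * f * c) ^ n = c⁻¹ * (f : G) ^ n * c := by
        simpa using (conj_zpow (a := c⁻¹) (b := (f : G)) (i := n))
      rwa [e] at this
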